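/- Let $d\in[1,+\infty]$, let $\mathbb D=\{z\in\mathbb C:|z|<1\}$, and write $\Delta=\{(s,t):0\le s\le t<+\infty\}$. A family $(f_t)_{t\ge0}$ of holomorphic self-maps of $\mathbb D$ is a *decreasing Loewner chain of order $d$* if each $f_t$ is univalent (injective); $f_0=\mathsf{id}_{\mathbb D}$ and $f_t(\mathbb D)\subset f_s(\mathbb D)$ for all $(s,t)\in\Delta$; and for every compact $K\subset\mathbb D$ and every $T>0$ there is a non-negative $k_{K,T}\in L^d([0,T],\mathbb R)$ such that $|f_s(z)-f_t(z)|\le\int_s^t k_{K,T}(\xi)\,d\xi$ for all $z\in K$ and $0\le s\le t\le T$. A family $(\varphi_{s,t})_{(s,t)\in\Delta}$ of holomorphic self-maps of $\mathbb D$ is a *reverse evolution family of order $d$* if $\varphi_{s,s}=\mathsf{id}_{\mathbb D}$ for all $s\ge0$; $\varphi_{s,t}=\varphi_{s,u}\circ\varphi_{u,t}$ whenever $0\le s\le u\le t$; and for every $z\in\mathbb D$ and every $T>0$ there is a non-negative $k_{z,T}\in L^d([0,T],\mathbb R)$ such that $|\varphi_{s,u}(z)-\varphi_{s,t}(z)|\le\int_u^t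 k_{z,T}(\xi)\,d\xi$ whenever $0\le s\le u\le t\le T$. **Theorem.** The formula $$\varphi_{s,t}:=f_s^{-1}\circ f_t,\qquad (s,t)\in\Delta, \tag{1}$$ establishes a one-to-one correspondence (a bijection) between decreasing Loewner chains $(f_t)$ of order $d$ and reverse evolution families $(\varphi_{s,t})$ of the same order $d$. Namely, for every decreasing Loewner chain $(f_t)$ of order $d$, the family $(\varphi_{s,t})$ defined by (1) is a reverse evolution family of order $d$. Conversely, for every reverse evolution family $(\varphi_{s,t})$ of order $d$, the family $(f_t)_{t\ge0}:=(\varphi_{0,t})_{t\ge0}$ is a decreasing Loewner chain of order $d$ and satisfies (1). -/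

import Mathlib

open MeasureTheory Set
open scoped NNReal ENNReal Complex.UnitDisc

namespace LoewnerDuality

/-- The triangle `Δ([0,∞)) = {(s,t) : 0 ≤ s ≤ t}`. -/
abbrev Triangle : Type := {p : ℝ≥0 × ℝ≥0 // p.1 ≤ p.2}

/-- The point `(s,t)` of the triangle. -/
def tri {s t : ℝ≥0} (h : s ≤ t) : Triangle := ⟨(s, t), h⟩

/-- A self-map of the unit disc is holomorphic: read in the coordinate of `ℂ`, it is
complex differentiable at every point of the open disc. (The values of `F` off the disc are
immaterial: the disc is open.) -/
def IsHolomorphic (f : 𝔻 → 𝔻) : Prop :=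
  ∃ F : ℂ → ℂ, DifferentiableOn ℂ F (Metric.ball 0 1) ∧ ∀ z : 𝔻, F (z : ℂ) = (f z : ℂ)

/-- `k` is a non-negative function of class `L^d([0,T], ℝ)`; its values off `[0,T]` are
immaterial. -/
def IsNonnegLd (d : ℝ≥0∞) (T : ℝ≥0) (k : ℝ → ℝ) : Prop :=
  MemLp k d (volume.restrict (Icc (0 : ℝ) T)) ∧ ∀ ξ ∈ Icc (0 : ℝ) T, 0 ≤ k ξ

/-- `(f_t)_{t ≥ 0}` is a decreasing Loewner chain of order `d`. -/
structure IsDecreasingLoewnerChain (d : ℝ≥0∞) (f : ℝ≥0 → 𝔻 → 𝔻) : Prop where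
  holomorphic : ∀ t, IsHolomorphic (f t)
  univalent : ∀ t, Function.Injective (f t)
  zero : f 0 = id
  range_subset : ∀ s t, s ≤ t → range (f t) ⊆ range (f s)
  regular : ∀ K : Set 𝔻, IsCompact K → ∀ T : ℝ≥0, 0 < T → ∃ k : ℝ → ℝ, IsNonnegLd d T k ∧
    ∀ z ∈ K, ∀ s t : ℝ≥0, s ≤ t → t ≤ T →
      ‖(f s z : ℂ) - (f t z : ℂ)‖ ≤ ∫ ξ in (s : ℝ)..t, k ξ

/-- `(φ_{s,t})_{0 ≤ s ≤ t}` is a reverse evolution family of order `d`. -/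
structure IsReverseEvolutionFamily (d : ℝ≥0∞) (φ : Triangle → 𝔻 → 𝔻) : Prop where
  holomorphic : ∀ p, IsHolomorphic (φ p)
  diag : ∀ s, φ (tri (le_refl s)) = id
  comp : ∀ (s u t : ℝ≥0) (hsu : s ≤ u) (hut : u ≤ t),
    φ (tri (hsu.trans hut)) = φ (tri hsu) ∘ φ (tri hut)
  regular : ∀ z : 𝔻, ∀ T : ℝ≥0, 0 < T → ∃ k : ℝ → ℝ, IsNonnegLd d T k ∧
    ∀ (s u t : ℝ≥0) (hsu : s ≤ u) (hut : u ≤ t), t ≤ T →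
      ‖(φ (tri hsu) z : ℂ) - (φ (tri (hsu.trans hut)) z : ℂ)‖ ≤ ∫ ξ in (u : ℝ)..t, k ξ

/-- The family `φ_{s,t} = f_s⁻¹ ∘ f_t`. `Function.invFun (f s)` is the inverse of the injective
map `f s` on its range, and the range of `f t` is contained in it when `(f_t)` is a decreasing
Loewner chain, so that no arbitrary value of `invFun` is used (see `apply_transition`). -/
noncomputable def transition (f : ℝ≥0 → 𝔻 → 𝔻) : Triangle → 𝔻 → 𝔻 :=
  fun p => Function.invFun (f p.1.1) ∘ f p.1.2

theorem apply_transition {d : ℝ≥0∞} {f : ℝ≥0 → 𝔻 → 𝔻} (hf : IsDecreasingLoewnerChain d f)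
    (p : Triangle) (z : 𝔻) : f p.1.1 (transition f p z) = f p.1.2 z :=
  Function.invFun_eq (hf.range_subset _ _ p.2 ⟨z, rfl⟩)

/-- The family `f_t = φ_{0,t}`. -/
def initial (φ : Triangle → 𝔻 → 𝔻) : ℝ≥0 → 𝔻 → 𝔻 :=
  fun t => φ (tri (bot_le : 0 ≤ t))

end LoewnerDuality

/-!
# Decreasing Loewner chains and reverse evolution families

The algebra of the correspondence is immediate from `f 0 = id` once the maps are known to be
univalent. Three analytic facts carry the proof, all consequences of the Schwarz–Pick lemma
(`schwarzPick`), which in particular makes every holomorphic self-map of the disc Lipschitz at `z`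
with a constant depending only on `z` (`IsHolomorphic.norm_map_sub_map_le`).

* *From pointwise to locally uniform regularity.* A holomorphic self-map which moves `0` and `1 / 2`
  by at most `ε` is `O(ε)`-close to the identity on compact sets
  (`IsHolomorphic.norm_sub_self_le`). Hence `C * (k₀ + k₁)`, with `k₀` and `k₁` controlling a reverse
  evolution family at these two points, controls it on a compact set. Since
  `φ_{s,u}(z) - φ_{s,t}(z) = φ_{s,u}(z) - φ_{s,u}(φ_{u,t}(z))`, the Lipschitz bound gives the
  regularity of the chain `φ_{0,t}`.
* *Univalence of reverse evolution families.* The backward orbits `u ↦ φ_{u,t}(z)` stay in a compact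
  set (`IsReverseEvolutionFamily.exists_norm_le`), and there `φ_{u,v}` is injective when `v - u` is
  small, being close to the identity (`IsHolomorphic.eq_of_map_eq`). Finitely many small steps
  separate any two orbits (`IsReverseEvolutionFamily.injective`).
* *Regularity of the transition maps of a chain.* The maps `f_s⁻¹ ∘ f_t` are holomorphic
  (`IsHolomorphic.of_comp_eq`). By the Lipschitz bound it suffices to control
  `z - φ_{u,t}(z)`, and `f_u(φ_{u,t}(z)) - f_u(z) = f_t(z) - f_u(z)` is controlled by the chain.
  So a lower Lipschitz bound for `f_u` at `z`, uniform for `u ≤ T`, is enough. It comes from applying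
  the Schwarz–Pick lemma to `f_u⁻¹` on a disc contained in the image of `f_u`
  (`IsHolomorphic.norm_sub_le_of_injective`); the radius of this disc is bounded below by compactness
  of `[0, T]` times a circle around `z` (`IsDecreasingLoewnerChain.exists_norm_sub_le`).
-/

/-! ### The Schwarz–Pick lemma -/

namespace LoewnerDuality

open Metric Filter Topology ComplexConjugate

theorem norm_one_sub_conj_mul_sq (a w : ℂ) :
    ‖1 - conj a * w‖ ^ 2 = ‖w - a‖ ^ 2 + (1 - ‖a‖ ^ 2) * (1 - ‖w‖ ^ 2) := by
  simp only [← Complex.normSq_eq_norm_sq, Complex.normSq_apply, Complex.sub_re, Complex.sub_im,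
    Complex.mul_re, Complex.mul_im, Complex.conj_re, Complex.conj_im, Complex.one_re,
    Complex.one_im]
  ring

theorem norm_sub_le_norm_one_sub_conj_mul {a w : ℂ} (ha : ‖a‖ ≤ 1) (hw : ‖w‖ ≤ 1) :
    ‖w - a‖ ≤ ‖1 - conj a * w‖ := by
  have h1 : ‖a‖ ^ 2 ≤ 1 := pow_le_one₀ (norm_nonneg _) ha
  have h2 : ‖w‖ ^ 2 ≤ 1 := pow_le_one₀ (norm_nonneg _) hw
  refine le_of_sq_le_sq ?_ (norm_nonneg _)
  rw [norm_one_sub_conj_mul_sq]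
  nlinarith [mul_nonneg (sub_nonneg.2 h1) (sub_nonneg.2 h2)]

theorem norm_sub_lt_norm_one_sub_conj_mul {a w : ℂ} (ha : ‖a‖ < 1) (hw : ‖w‖ < 1) :
    ‖w - a‖ < ‖1 - conj a * w‖ := by
  have h1 : ‖a‖ ^ 2 < 1 := pow_lt_one₀ (norm_nonneg _) ha two_ne_zero
  have h2 : ‖w‖ ^ 2 < 1 := pow_lt_one₀ (norm_nonneg _) hw two_ne_zero
  refine lt_of_pow_lt_pow_left₀ 2 (norm_nonneg _) ?_
  rw [norm_one_sub_conj_mul_sq]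
  nlinarith [mul_pos (sub_pos.2 h1) (sub_pos.2 h2)]

theorem one_sub_conj_mul_ne_zero {a w : ℂ} (ha : ‖a‖ < 1) (hw : ‖w‖ < 1) :
    1 - conj a * w ≠ 0 :=
  norm_pos_iff.1 ((norm_nonneg _).trans_lt (norm_sub_lt_norm_one_sub_conj_mul ha hw))

theorem schwarzPick_of_mapsTo_ball {F : ℂ → ℂ} (hF : DifferentiableOn ℂ F (ball 0 1))
    (hm : MapsTo F (ball 0 1) (ball 0 1)) {z w : ℂ} (hz : ‖z‖ < 1) (hw : ‖w‖ < 1) :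
    ‖F z - F w‖ * ‖1 - conj w * z‖ ≤ ‖z - w‖ * ‖1 - conj (F w) * F z‖ := by
  have hm' : ∀ x : ℂ, ‖x‖ < 1 → ‖F x‖ < 1 := fun x hx => by simpa using hm (by simpa using hx)
  -- `A` is the disc automorphism taking `0` to `w`, and `B` one taking `F w` to `0`
  set A : ℂ → ℂ := fun ζ => (ζ + w) / (1 + conj w * ζ) with hA
  set B : ℂ → ℂ := fun ζ => (ζ - F w) / (1 - conj (F w) * ζ) with hB
  have hAne : ∀ ζ : ℂ, ‖ζ‖ < 1 → 1 + conj w * ζ ≠ 0 := fun ζ hζ => by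
    simpa using one_sub_conj_mul_ne_zero (a := -w) (by simpa using hw) hζ
  have hAm : ∀ ζ : ℂ, ‖ζ‖ < 1 → ‖A ζ‖ < 1 := fun ζ hζ => by
    have := norm_sub_lt_norm_one_sub_conj_mul (a := -w) (by simpa using hw) hζ
    rw [hA, norm_div, div_lt_one (norm_pos_iff.2 (hAne ζ hζ))]
    simpa using this
  have hBm : ∀ ζ : ℂ, ‖ζ‖ < 1 → ‖B ζ‖ ≤ 1 := fun ζ hζ => by
    rw [hB, norm_div]
    exact div_le_one_of_le₀ (norm_sub_le_norm_one_sub_conj_mul (hm' w hw).le hζ.le)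
      (norm_nonneg _)
  have hAd : DifferentiableOn ℂ A (ball 0 1) := by
    refine DifferentiableOn.div (by fun_prop) (by fun_prop) fun ζ hζ => hAne ζ (by simpa using hζ)
  have hBd : DifferentiableOn ℂ B (ball 0 1) := by
    refine DifferentiableOn.div (by fun_prop) (by fun_prop) fun ζ hζ =>
      one_sub_conj_mul_ne_zero (hm' w hw) (by simpa using hζ)
  have hAm' : MapsTo A (ball 0 1) (ball 0 1) := fun ζ hζ => by
    simpa using hAm ζ (by simpa using hζ)
  have hG : DifferentiableOn ℂ (B ∘ F ∘ A) (ball 0 1) :=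
    hBd.comp (hF.comp hAd hAm') (hm.comp hAm')
  have hGm : MapsTo (B ∘ F ∘ A) (ball 0 1) (closedBall 0 1) := fun ζ hζ => by
    simpa using hBm _ (hm' _ (hAm ζ (by simpa using hζ)))
  have hG0 : (B ∘ F ∘ A) 0 = 0 := by simp [hA, hB]
  set ζ : ℂ := (z - w) / (1 - conj w * z) with hζ
  have hzw := one_sub_conj_mul_ne_zero hw hz
  have hζ1 : ‖ζ‖ < 1 := by
    rw [hζ, norm_div, div_lt_one (norm_pos_iff.2 hzw)]
    exact norm_sub_lt_norm_one_sub_conj_mul hw hz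
  have hAζ : A ζ = z := by
    have h := hAne ζ hζ1
    rw [hA]
    simp only
    have e : ζ * (1 - conj w * z) = z - w := div_mul_cancel₀ _ hzw
    rw [div_eq_iff h]
    linear_combination e
  have key := Complex.norm_le_norm_of_mapsTo_ball hG hGm hG0 hζ1
  simp only [Function.comp_apply, hAζ] at key
  have hFzw := one_sub_conj_mul_ne_zero (hm' w hw) (hm' z hz)
  rwa [hB, hζ, norm_div, norm_div, div_le_div_iff₀ (norm_pos_iff.2 hFzw)
    (norm_pos_iff.2 hzw)] at key

/-- The Schwarz–Pick inequality, for maps into the closed disc. -/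
theorem schwarzPick {F : ℂ → ℂ} (hF : DifferentiableOn ℂ F (ball 0 1))
    (hm : MapsTo F (ball 0 1) (closedBall 0 1)) {z w : ℂ} (hz : ‖z‖ < 1) (hw : ‖w‖ < 1) :
    ‖F z - F w‖ * ‖1 - conj w * z‖ ≤ ‖z - w‖ * ‖1 - conj (F w) * F z‖ := by
  -- apply the previous inequality to `r * F` and let `r` tend to `1`
  have h : ∀ r ∈ Ioo (0 : ℝ) 1, ‖r * F z - r * F w‖ * ‖1 - conj w * z‖ ≤
      ‖z - w‖ * ‖1 - conj (r * F w) * (r * F z)‖ := fun r hr => by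
    refine schwarzPick_of_mapsTo_ball (F := fun x => r * F x) (hF.const_mul _) (fun x hx => ?_)
      hz hw
    have : ‖F x‖ ≤ 1 := by simpa using hm hx
    simp only [mem_ball_zero_iff, norm_mul, Complex.norm_real, Real.norm_eq_abs, abs_of_pos hr.1]
    nlinarith [hr.1, hr.2]
  have hlim : ∀ᶠ r : ℝ in 𝓝[<] 1, r ∈ Ioo (0 : ℝ) 1 := Ioo_mem_nhdsLT one_pos
  have hl : Tendsto (fun r : ℝ => ‖r * F z - r * F w‖ * ‖1 - conj w * z‖) (𝓝[<] 1)
      (𝓝 (‖((1 : ℝ) : ℂ) * F z - ((1 : ℝ) : ℂ) * F w‖ * ‖1 - conj w * z‖)) :=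
    Tendsto.mono_left (Continuous.tendsto (by fun_prop) _) nhdsWithin_le_nhds
  have hr : Tendsto (fun r : ℝ => ‖z - w‖ * ‖1 - conj (r * F w) * (r * F z)‖) (𝓝[<] 1)
      (𝓝 (‖z - w‖ * ‖1 - conj (((1 : ℝ) : ℂ) * F w) * (((1 : ℝ) : ℂ) * F z)‖)) := by
    refine Tendsto.mono_left (Continuous.tendsto ?_ _) nhdsWithin_le_nhds
    have : Continuous fun x : ℂ => conj x := Complex.continuous_conj
    fun_prop
  simpa using le_of_tendsto_of_tendsto hl hr (hlim.mono h)

theorem mapsTo_closedBall_of_coe_eq {f : 𝔻 → 𝔻} {F : ℂ → ℂ}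
    (hFf : ∀ z : 𝔻, F (z : ℂ) = (f z : ℂ)) : MapsTo F (ball 0 1) (closedBall 0 1) := fun x hx => by
  have hx' : ‖x‖ < 1 := by simpa using hx
  have := hFf (.mk x hx')
  rw [Complex.UnitDisc.coe_mk] at this
  simpa [this] using (f (.mk x hx')).norm_lt_one.le

/-- A holomorphic self-map of the disc is Lipschitz at `z` with a constant depending on `z`
only. -/
theorem IsHolomorphic.norm_map_sub_map_le {f : 𝔻 → 𝔻} (hf : IsHolomorphic f) (z w : 𝔻) :
    ‖(f z : ℂ) - f w‖ ≤ 2 / (1 - ‖(z : ℂ)‖) * ‖(z : ℂ) - w‖ := by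
  obtain ⟨F, hF, hFf⟩ := hf
  have key := schwarzPick hF (mapsTo_closedBall_of_coe_eq hFf) z.norm_lt_one w.norm_lt_one
  rw [hFf, hFf] at key
  have h1 : 1 - ‖(z : ℂ)‖ ≤ ‖1 - conj (w : ℂ) * z‖ := by
    have := norm_sub_norm_le (1 : ℂ) (conj (w : ℂ) * z)
    rw [norm_one, norm_mul, Complex.norm_conj] at this
    nlinarith [w.norm_lt_one, norm_nonneg (z : ℂ)]
  have h2 : ‖1 - conj (f w : ℂ) * f z‖ ≤ 2 := by
    have := norm_sub_le (1 : ℂ) (conj (f w : ℂ) * f z)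
    rw [norm_one, norm_mul, Complex.norm_conj] at this
    nlinarith [(f w).norm_lt_one, (f z).norm_lt_one, norm_nonneg (f z : ℂ),
      norm_nonneg (f w : ℂ)]
  have h3 : 0 < 1 - ‖(z : ℂ)‖ := sub_pos.2 z.norm_lt_one
  rw [div_mul_eq_mul_div, le_div_iff₀ h3]
  calc ‖(f z : ℂ) - f w‖ * (1 - ‖(z : ℂ)‖) ≤ ‖(f z : ℂ) - f w‖ * ‖1 - conj (w : ℂ) * z‖ := by
        gcongr
    _ ≤ ‖(z : ℂ) - w‖ * ‖1 - conj (f w : ℂ) * f z‖ := key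
    _ ≤ ‖(z : ℂ) - w‖ * 2 := by gcongr
    _ = _ := mul_comm _ _

/-- The image of a disc of radius `R` under a map not moving `0` far lies in a disc whose radius is
less than `1` and depends on `R` only. -/
theorem IsHolomorphic.norm_le_of_norm_zero_le {f : 𝔻 → 𝔻} (hf : IsHolomorphic f) {R : ℝ}
    (h0 : ‖(f 0 : ℂ)‖ ≤ 1 / 2) {y : 𝔻} (hy : ‖(y : ℂ)‖ ≤ R) (hR : R < 1) :
    ‖(f y : ℂ)‖ ≤ 1 - (1 - R) / 8 := by
  obtain ⟨F, hF, hFf⟩ := hf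
  have key := schwarzPick hF (mapsTo_closedBall_of_coe_eq hFf) y.norm_lt_one
    (Complex.UnitDisc.norm_lt_one 0)
  rw [hFf, hFf] at key
  simp only [Complex.UnitDisc.coe_zero, map_zero, zero_mul, sub_zero, norm_one, mul_one] at key
  have hid := norm_one_sub_conj_mul_sq (f 0 : ℂ) (f y)
  set N := ‖1 - conj (f 0 : ℂ) * f y‖
  have hN : 1 / 2 ≤ N := by
    have := norm_sub_norm_le (1 : ℂ) (conj (f 0 : ℂ) * f y)
    rw [norm_one, norm_mul, Complex.norm_conj] at this
    nlinarith [(f y).norm_lt_one, norm_nonneg (f y : ℂ), norm_nonneg (f 0 : ℂ)]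
  have hy0 := norm_nonneg (y : ℂ)
  have hb0 := norm_nonneg (f y : ℂ)
  have hb1 := (f y).norm_lt_one
  have key2 : ‖(f y : ℂ) - f 0‖ ^ 2 ≤ R ^ 2 * N ^ 2 := by
    rw [← mul_pow]
    refine pow_le_pow_left₀ (norm_nonneg _) (key.trans ?_) 2
    gcongr
  have hb2 : 0 ≤ 1 - ‖(f y : ℂ)‖ ^ 2 := by nlinarith
  have h1 : (1 - R ^ 2) * N ^ 2 ≤ 1 - ‖(f y : ℂ)‖ ^ 2 := by
    nlinarith [mul_nonneg (sq_nonneg ‖(f 0 : ℂ)‖) hb2]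
  have h2 : (1 - R ^ 2) * (1 / 4) ≤ (1 - R ^ 2) * N ^ 2 := by
    have : 0 ≤ 1 - R ^ 2 := by nlinarith
    gcongr
    nlinarith
  nlinarith

/-! ### Quantitative rigidity at the identity -/

/-- The point `1 / 2` of the disc. -/
noncomputable def half : 𝔻 := .mk (1 / 2) (by norm_num)

theorem coe_half : (half : ℂ) = 1 / 2 := Complex.UnitDisc.coe_mk _ _

/-- A Harnack-type inequality: if `a` and `b` are values of a holomorphic function bounded by `1`, at
points of pseudo-hyperbolic distance at most `r`, then their distances to `1` are comparable. -/
theorem norm_one_sub_le_of_schwarzPick {a b : ℂ} {r : ℝ} (hr0 : 0 ≤ r) (hr : r < 1)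
    (ha : ‖a‖ ≤ 1) (h : ‖b - a‖ ≤ r * ‖1 - conj a * b‖) :
    ‖1 - b‖ ≤ (1 + r) / (1 - r) * ‖1 - a‖ := by
  have h1 : ‖1 - b‖ ≤ ‖1 - a‖ + ‖b - a‖ := by
    have : 1 - b = (1 - a) - (b - a) := by ring
    rw [this]
    exact norm_sub_le _ _
  have h2 : ‖1 - conj a * b‖ ≤ ‖1 - a‖ + ‖1 - b‖ := by
    have e : 1 - conj a * b = conj (1 - a) + conj a * (1 - b) := by
      rw [map_sub, map_one]; ring
    rw [e]
    refine (norm_add_le _ _).trans ?_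
    rw [norm_mul, Complex.norm_conj, Complex.norm_conj]
    nlinarith [norm_nonneg (1 - b)]
  rw [div_mul_eq_mul_div, le_div_iff₀ (by linarith)]
  nlinarith

/-- A holomorphic self-map of the disc which moves the two points `0` and `1 / 2` by at most `ε`
is at distance `O(ε)` from the identity, uniformly on compact sets. -/
theorem IsHolomorphic.norm_sub_self_le {f : 𝔻 → 𝔻} (hf : IsHolomorphic f) {ε R : ℝ}
    (h0 : ‖(f 0 : ℂ)‖ ≤ ε) (h1 : ‖(f half : ℂ) - half‖ ≤ ε) (hR : R < 1) {z : 𝔻}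
    (hz : ‖(z : ℂ)‖ ≤ R) : ‖(f z : ℂ) - z‖ ≤ 38 / (1 - R) * ε := by
  obtain ⟨F, hF, hFf⟩ := hf
  set a : ℂ := (f 0 : ℂ) with ha
  have hFm : ∀ x : ℂ, ‖x‖ < 1 → ‖F x‖ < 1 := fun x hx => by
    have := hFf (.mk x hx)
    rw [Complex.UnitDisc.coe_mk] at this
    simpa [this] using (f (.mk x hx)).norm_lt_one
  have ha1 : ‖a‖ < 1 := (f 0).norm_lt_one
  have hF0 : F 0 = a := by simpa using hFf 0
  have hne : ∀ x : ℂ, ‖x‖ < 1 → 1 - conj a * F x ≠ 0 := fun x hx =>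
    one_sub_conj_mul_ne_zero ha1 (hFm x hx)
  -- normalize the value at `0` and divide by the coordinate: `f - a = z h (1 - conj a * f)`
  set ψ : ℂ → ℂ := fun x => (F x - a) / (1 - conj a * F x) with hψ
  have hψ0 : ψ 0 = 0 := by simp [hψ, hF0]
  have hψd : DifferentiableOn ℂ ψ (ball 0 1) := by
    refine DifferentiableOn.div (by fun_prop) (by fun_prop) fun x hx => hne x (by simpa using hx)
  have hψm : MapsTo ψ (ball 0 1) (closedBall (ψ 0) 1) := fun x hx => by
    have hx' : ‖x‖ < 1 := by simpa using hx
    rw [hψ0, mem_closedBall_zero_iff, hψ, norm_div]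
    exact div_le_one_of_le₀ (norm_sub_le_norm_one_sub_conj_mul ha1.le (hFm x hx').le)
      (norm_nonneg _)
  set h : ℂ → ℂ := dslope ψ 0 with hh
  have hhd : DifferentiableOn ℂ h (ball 0 1) :=
    (Complex.differentiableOn_dslope (ball_mem_nhds 0 one_pos)).2 hψd
  have hhm : MapsTo h (ball 0 1) (closedBall 0 1) := fun x hx => by
    simpa using Complex.norm_dslope_le_div_of_mapsTo_ball hψd hψm hx
  have hh1 : ∀ x : ℂ, ‖x‖ < 1 → ‖h x‖ ≤ 1 := fun x hx => by simpa using hhm (by simpa using hx)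
  have hfac : ∀ x : 𝔻, (f x : ℂ) - a = x * h x * (1 - conj a * f x) := fun x => by
    have e := sub_smul_dslope ψ 0 (x : ℂ)
    rw [sub_zero, hψ0, sub_zero, smul_eq_mul] at e
    have hx := hne x x.norm_lt_one
    rw [hh, e, hψ]
    simp only
    rw [← hFf]
    exact (div_mul_cancel₀ _ hx).symm
  have herr : ∀ x : 𝔻, ‖(x : ℂ) * h x * (conj a * f x)‖ ≤ ε := fun x => by
    rw [norm_mul, norm_mul, norm_mul, Complex.norm_conj]
    have e1 : ‖(x : ℂ)‖ * ‖h x‖ ≤ 1 := mul_le_one₀ x.norm_lt_one.le (norm_nonneg _)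
      (hh1 x x.norm_lt_one)
    have e2 : ‖a‖ * ‖(f x : ℂ)‖ ≤ ‖a‖ :=
      mul_le_of_le_one_right (norm_nonneg _) (f x).norm_lt_one.le
    calc _ ≤ 1 * ‖a‖ := by gcongr
      _ ≤ ε := by rwa [one_mul]
  have hhalf : ‖1 - h half‖ ≤ 6 * ε := by
    have e : (half : ℂ) * (1 - h half) =
        -((f half : ℂ) - half) + a - half * h half * (conj a * f half) := by
      linear_combination hfac half
    have e2 := (norm_sub_le (-((f half : ℂ) - half) + a) (half * h half * (conj a * f half))).trans
      (add_le_add_left (norm_add_le _ _) _)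
    rw [← e, norm_mul, norm_neg] at e2
    have e3 := herr half
    have e4 : ‖(half : ℂ)‖ = 1 / 2 := by rw [coe_half]; norm_num
    rw [e4] at e2
    linarith
  have hzero : ‖1 - h 0‖ ≤ 3 * ‖1 - h half‖ := by
    have e := schwarzPick hhd hhm (z := 0) (w := half) (by simp) half.norm_lt_one
    rw [mul_zero, sub_zero, norm_one, mul_one, zero_sub, norm_neg] at e
    have e4 : ‖(half : ℂ)‖ = 1 / 2 := by rw [coe_half]; norm_num
    rw [e4] at e
    refine (norm_one_sub_le_of_schwarzPick (by norm_num) (by norm_num)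
      (hh1 _ half.norm_lt_one) e).trans_eq ?_
    norm_num
  have hR0 : 0 ≤ R := (norm_nonneg _).trans hz
  have hz' : ‖1 - h z‖ ≤ (1 + R) / (1 - R) * ‖1 - h 0‖ := by
    have e := schwarzPick hhd hhm (z := z) (w := 0) z.norm_lt_one (by simp)
    rw [map_zero, zero_mul, sub_zero, sub_zero, norm_one, mul_one] at e
    refine norm_one_sub_le_of_schwarzPick hR0 hR (hh1 0 (by simp)) (e.trans ?_)
    gcongr
  have hfin : ‖(f z : ℂ) - z‖ ≤ 2 * ε + ‖1 - h z‖ := by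
    have e : (f z : ℂ) - z = a - z * (1 - h z) - z * h z * (conj a * f z) := by
      linear_combination hfac z
    rw [e]
    have e2 := (norm_sub_le (a - z * (1 - h z)) (z * h z * (conj a * f z))).trans
      (add_le_add_left (norm_sub_le _ _) _)
    rw [norm_mul (z : ℂ) (1 - h z)] at e2
    have e3 := herr z
    nlinarith [z.norm_lt_one, norm_nonneg (1 - h z), norm_nonneg (z : ℂ)]
  have hε : 0 ≤ ε := (norm_nonneg _).trans h0
  have hR1 : 0 < 1 - R := sub_pos.2 hR
  calc ‖(f z : ℂ) - z‖ ≤ 2 * ε + (1 + R) / (1 - R) * (3 * (6 * ε)) := by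
        refine hfin.trans ?_
        gcongr
        refine hz'.trans ?_
        gcongr
        exact hzero.trans (by gcongr)
    _ = (2 * (1 - R) + 18 * (1 + R)) / (1 - R) * ε := by field_simp; ring
    _ ≤ 38 / (1 - R) * ε := by
        gcongr
        linarith

/-- If `f` moves every point of the disc of radius `R + r` by at most `η < r / 2`, then `f` is
injective on the disc of radius `R`: by the Schwarz lemma on discs of radius `r`, the map `f - id`
has there a Lipschitz constant `2 * η / r < 1`. -/
theorem IsHolomorphic.eq_of_map_eq {f : 𝔻 → 𝔻} (hf : IsHolomorphic f) {η R r : ℝ} (hη : 0 ≤ η)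
    (hr : 2 * η < r) (hR : R + r ≤ 1) (h : ∀ z : 𝔻, ‖(z : ℂ)‖ ≤ R + r → ‖(f z : ℂ) - z‖ ≤ η)
    {y₁ y₂ : 𝔻} (h₁ : ‖(y₁ : ℂ)‖ ≤ R) (h₂ : ‖(y₂ : ℂ)‖ ≤ R) (he : f y₁ = f y₂) : y₁ = y₂ := by
  obtain ⟨F, hF, hFf⟩ := hf
  have hr0 : 0 < r := by linarith
  by_contra hne
  have hpos : 0 < dist (y₁ : ℂ) y₂ := dist_pos.2 fun e => hne (Complex.UnitDisc.coe_injective e)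
  have hball : ∀ x ∈ ball (y₂ : ℂ) r, ‖x‖ < R + r := fun x hx => by
    rw [mem_ball_iff_norm] at hx
    have := norm_le_norm_add_norm_sub' x (y₂ : ℂ)
    linarith
  have hb : ∀ x : ℂ, ‖x‖ < R + r → ‖F x - x‖ ≤ η := fun x hx => by
    have e := h (.mk x (hx.trans_le hR)) (by rw [Complex.UnitDisc.coe_mk]; exact hx.le)
    rwa [← hFf, Complex.UnitDisc.coe_mk] at e
  have hd : dist (F y₁ - y₁) (F y₂ - y₂) = dist (y₁ : ℂ) y₂ := by
    rw [hFf, hFf, he, dist_sub_left]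
  have hsm : ∀ x : ℂ, ‖x‖ < R + r → dist (F x - x) (F y₂ - y₂) ≤ 2 * η := fun x hx => by
    rw [dist_eq_norm]
    refine (norm_sub_le _ _).trans ?_
    linarith [hb x hx, hb y₂ (by linarith)]
  by_cases hy : (y₁ : ℂ) ∈ ball (y₂ : ℂ) r
  · have hgd : DifferentiableOn ℂ (fun x => F x - x) (ball (y₂ : ℂ) r) :=
      (hF.mono fun x hx => by simpa using (hball x hx).trans_le hR).sub differentiableOn_id
    have key := Complex.dist_le_div_mul_dist_of_mapsTo_ball hgd
      (fun x hx => mem_closedBall.2 (hsm x (hball x hx))) hy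
    rw [hd] at key
    have : 2 * η / r < 1 := (div_lt_one hr0).2 hr
    nlinarith
  · have := hsm y₁ (by linarith)
    rw [hd] at this
    rw [mem_ball, not_lt] at hy
    linarith

end LoewnerDuality

/-! ### Inverses of univalent functions -/

namespace LoewnerDuality

open Metric Filter Topology

theorem injOn_ball_of_injective {f : 𝔻 → 𝔻} {F : ℂ → ℂ} (hFf : ∀ z : 𝔻, F (z : ℂ) = (f z : ℂ))
    (hinj : Function.Injective f) : InjOn F (ball 0 1) := fun x hx y hy hxy => by
  have hx' : ‖x‖ < 1 := by simpa using hx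
  have hy' : ‖y‖ < 1 := by simpa using hy
  have ex := hFf (.mk x hx')
  have ey := hFf (.mk y hy')
  rw [Complex.UnitDisc.coe_mk] at ex ey
  rw [ex, ey, Complex.UnitDisc.coe_inj] at hxy
  exact (Complex.UnitDisc.mk_inj _ _).1 (hinj hxy)

/-- An injective function on the plane is not locally constant. -/
theorem not_eventually_eq_of_injOn {F : ℂ → ℂ} {U : Set ℂ} {c : ℂ} (hU : U ∈ 𝓝 c)
    (hF : InjOn F U) : ¬ ∀ᶠ x in 𝓝 c, F x = F c := fun h => by
  have h' : ∀ᶠ x in 𝓝[≠] c, F x = F c ∧ x ∈ U ∧ x ≠ c :=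
    ((h.and hU).filter_mono nhdsWithin_le_nhds |>.and self_mem_nhdsWithin).mono
      fun x hx => ⟨hx.1.1, hx.1.2, hx.2⟩
  obtain ⟨x, hx1, hx2, hx3⟩ := h'.exists
  exact hx3 (hF hx2 (mem_of_mem_nhds hU) hx1)

/-- If `f` and `g` are univalent and `g = f ∘ ψ`, then `ψ = f⁻¹ ∘ g` is holomorphic: it is
continuous because `f` is open, holomorphic where `f'` does not vanish at `ψ`, and the remaining
points are isolated, hence removable. -/
theorem IsHolomorphic.of_comp_eq {f g ψ : 𝔻 → 𝔻} (hf : IsHolomorphic f) (hg : IsHolomorphic g)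
    (hfi : Function.Injective f) (hgi : Function.Injective g) (h : ∀ z, f (ψ z) = g z) :
    IsHolomorphic ψ := by
  obtain ⟨F, hF, hFf⟩ := hf
  obtain ⟨G, hG, hGg⟩ := hg
  have hψi : Function.Injective ψ := fun x y hxy => hgi (by rw [← h, ← h, hxy])
  set Ψ : ℂ → ℂ := fun z => if hz : ‖z‖ < 1 then (ψ (.mk z hz) : ℂ) else 0 with hΨ
  have hΨψ : ∀ z : 𝔻, Ψ z = ψ z := fun z => by
    rw [hΨ]
    simp only [z.norm_lt_one, dif_pos, Complex.UnitDisc.mk_coe]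
  have hΨm : ∀ z ∈ ball (0 : ℂ) 1, Ψ z ∈ ball (0 : ℂ) 1 := fun z hz => by
    lift z to 𝔻 using by simpa using hz
    simpa [hΨψ] using (ψ z).norm_lt_one
  have hFΨ : ∀ z ∈ ball (0 : ℂ) 1, F (Ψ z) = G z := fun z hz => by
    lift z to 𝔻 using by simpa using hz
    rw [hΨψ, hFf, hGg, h]
  have hFi := injOn_ball_of_injective hFf hfi
  have hΨi := injOn_ball_of_injective hΨψ hψi
  have hB : ∀ z ∈ ball (0 : ℂ) 1, ball (0 : ℂ) 1 ∈ 𝓝 z := fun z hz => isOpen_ball.mem_nhds hz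
  have hFan : ∀ z ∈ ball (0 : ℂ) 1, AnalyticAt ℂ F z := fun z hz => hF.analyticAt (hB z hz)
  have hcont : ∀ z ∈ ball (0 : ℂ) 1, ContinuousAt Ψ z := fun z hz => by
    have hc := hΨm z hz
    have hmap : 𝓝 (F (Ψ z)) ≤ map F (𝓝 (Ψ z)) :=
      ((hFan _ hc).eventually_constant_or_nhds_le_map_nhds).resolve_left
        (not_eventually_eq_of_injOn (hB _ hc) hFi)
    intro U hU
    have hV : F '' (U ∩ ball 0 1) ∈ 𝓝 (G z) := by
      rw [← hFΨ z hz]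
      exact hmap (image_mem_map (inter_mem hU (hB _ hc)))
    have hGc : ContinuousAt G z := (hG.continuousOn).continuousAt (hB z hz)
    rw [mem_map]
    filter_upwards [hGc hV, hB z hz] with x hx hxb
    obtain ⟨u, hu, hux⟩ := hx
    rw [← hFΨ x hxb] at hux
    exact mem_preimage.2 (hFi hu.2 (hΨm x hxb) hux ▸ hu.1)
  have hreg : ∀ z ∈ ball (0 : ℂ) 1, deriv F (Ψ z) ≠ 0 → DifferentiableAt ℂ Ψ z := by
    intro z hz hd
    have hs := (hFan _ (hΨm z hz)).hasStrictDerivAt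
    have hI := (hs.to_localInverse hd).hasDerivAt.differentiableAt
    rw [hFΨ z hz] at hI
    have hc := hI.comp z (hG.differentiableAt (hB z hz))
    refine hc.congr_of_eventuallyEq ?_
    have hl := (hs.hasStrictFDerivAt_equiv hd).eventually_left_inverse
    filter_upwards [(hcont z hz).eventually hl, hB z hz] with x hx hxb
    rw [Function.comp_apply, ← hFΨ x hxb]
    exact hx.symm
  refine ⟨Ψ, fun z hz => DifferentiableAt.differentiableWithinAt ?_, hΨψ⟩
  have hc := hΨm z hz
  rcases (hFan _ hc).deriv.eventually_eq_zero_or_eventually_ne_zero with h0 | h0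
  · -- `F` is not locally constant
    obtain ⟨r, hr, hrs⟩ := Metric.eventually_nhds_iff_ball.1
      (h0.and (isOpen_ball.eventually_mem hc))
    refine absurd ?_ (not_eventually_eq_of_injOn (hB _ hc) hFi)
    filter_upwards [ball_mem_nhds (Ψ z) hr] with x hx
    exact isOpen_ball.is_const_of_deriv_eq_zero (convex_ball (Ψ z) r).isPreconnected
      (hF.mono fun y hy => (hrs y hy).2) (fun y hy => (hrs y hy).1) hx (mem_ball_self hr)
  · refine (Complex.analyticAt_of_differentiable_on_punctured_nhds_of_continuousAt ?_
      (hcont z hz)).differentiableAt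
    have ht : Tendsto Ψ (𝓝[≠] z) (𝓝[≠] (Ψ z)) := by
      refine tendsto_nhdsWithin_iff.2 ⟨(hcont z hz).tendsto.mono_left nhdsWithin_le_nhds, ?_⟩
      filter_upwards [nhdsWithin_le_nhds (hB z hz), self_mem_nhdsWithin] with x hx hxz hΨx
      exact hxz (hΨi hx hz hΨx)
    filter_upwards [ht.eventually h0, nhdsWithin_le_nhds (hB z hz)] with x hx hxb
    exact hreg x hxb hx

/-- A univalent function is bi-Lipschitz from below at `z`, with a constant depending only on a
lower bound for `|f w - f z|` on a circle around `z`: the image contains a disc around `f z`, and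
the Schwarz–Pick lemma applies to the inverse of `f` there. -/
theorem IsHolomorphic.norm_sub_le_of_injective {f : 𝔻 → 𝔻} (hf : IsHolomorphic f)
    (hfi : Function.Injective f) {z : 𝔻} {r ε : ℝ} (hr : 0 < r) (hε : 0 < ε)
    (hrz : closedBall (z : ℂ) r ⊆ ball 0 1)
    (hs : ∀ w : 𝔻, (w : ℂ) ∈ sphere (z : ℂ) r → ε ≤ ‖(f w : ℂ) - f z‖) (w : 𝔻) :
    ‖(w : ℂ) - z‖ ≤ 4 / ε * ‖(f w : ℂ) - f z‖ := by
  -- far from `f z` the trivial bound `‖w - z‖ ≤ 2` suffices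
  rcases le_or_gt (ε / 2) ‖(f w : ℂ) - f z‖ with hw | hw
  · calc ‖(w : ℂ) - z‖ ≤ ‖(w : ℂ)‖ + ‖(z : ℂ)‖ := norm_sub_le _ _
      _ ≤ 4 / ε * (ε / 2) := by
        have : 4 / ε * (ε / 2) = 2 := by field_simp; norm_num
        linarith [w.norm_lt_one, z.norm_lt_one]
      _ ≤ _ := by gcongr
  have hf' := hf
  obtain ⟨F, hF, hFf⟩ := hf
  have hDC : DiffContOnCl ℂ F (ball (z : ℂ) r) := (hF.mono hrz).diffContOnCl_ball subset_rfl
  have himg := hDC.ball_subset_image_closedBall hr (ε := ε) (fun x hx => by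
      lift x to 𝔻 using by simpa using hrz (sphere_subset_closedBall hx)
      rw [hFf, hFf]
      exact hs x hx) (by
      have := not_eventually_eq_of_injOn (isOpen_ball.mem_nhds (by simpa using z.norm_lt_one))
        (injOn_ball_of_injective hFf hfi)
      exact Filter.not_eventually.1 this)
  have hex : ∀ ζ : 𝔻, ∃ u : 𝔻, (f u : ℂ) = f z + (ε / 2 : ℝ) * (ζ : ℂ) := fun ζ => by
    have hmem : (f z : ℂ) + (ε / 2 : ℝ) * (ζ : ℂ) ∈ ball (F z) (ε / 2) := by
      rw [hFf, mem_ball_iff_norm, add_sub_cancel_left, norm_mul, Complex.norm_real,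
        Real.norm_of_nonneg (by positivity)]
      exact mul_lt_of_lt_one_right (by positivity) ζ.norm_lt_one
    obtain ⟨u, hu, hu'⟩ := himg hmem
    lift u to 𝔻 using by simpa using hrz hu
    exact ⟨u, by rw [← hFf, hu']⟩
  -- `ψ` is the inverse of `f` on the disc of radius `ε / 2` around `f z`, rescaled to `𝔻`
  choose ψ hψ using hex
  have hε2 : ((ε / 2 : ℝ) : ℂ) ≠ 0 := by
    rw [Complex.ofReal_ne_zero]
    positivity
  have hψh : IsHolomorphic ψ := by
    refine hf'.of_comp_eq (g := f ∘ ψ) ⟨fun ζ => f z + (ε / 2 : ℝ) * ζ, by fun_prop,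
      fun ζ => (hψ ζ).symm⟩ hfi (fun x y hxy => ?_) (fun _ => rfl)
    have e := congrArg (fun t : 𝔻 => (t : ℂ)) hxy
    simp only [Function.comp_apply, hψ] at e
    exact Complex.UnitDisc.coe_injective (mul_left_cancel₀ hε2 (add_left_cancel e))
  have hψ0 : ψ 0 = z := hfi (Complex.UnitDisc.coe_injective (by rw [hψ]; simp))
  -- `w = ψ ζ` for the point `ζ` of the disc corresponding to `f w`
  have hζ : ‖((f w : ℂ) - f z) / (ε / 2 : ℝ)‖ < 1 := by
    rwa [norm_div, Complex.norm_real, Real.norm_of_nonneg (by positivity),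
      div_lt_one (by positivity)]
  set ζ : 𝔻 := .mk _ hζ with hζd
  have hψζ : ψ ζ = w := hfi (Complex.UnitDisc.coe_injective (by
    rw [hψ, hζd, Complex.UnitDisc.coe_mk, mul_div_cancel₀ _ hε2, add_sub_cancel]))
  have key := hψh.norm_map_sub_map_le 0 ζ
  rw [hψ0, hψζ, hζd, Complex.UnitDisc.coe_mk, Complex.UnitDisc.coe_zero, norm_zero, zero_sub,
    norm_neg, norm_div, Complex.norm_real, Real.norm_of_nonneg (by positivity), norm_sub_rev]
    at key
  refine key.trans_eq ?_
  field_simp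
  ring

end LoewnerDuality

/-! ### Control functions -/

namespace LoewnerDuality

open Metric Filter Topology

variable {d : ℝ≥0∞} {T : ℝ≥0} {k k₁ k₂ : ℝ → ℝ}

theorem IsNonnegLd.add (h₁ : IsNonnegLd d T k₁) (h₂ : IsNonnegLd d T k₂) :
    IsNonnegLd d T (fun ξ => k₁ ξ + k₂ ξ) :=
  ⟨h₁.1.add h₂.1, fun ξ hξ => add_nonneg (h₁.2 ξ hξ) (h₂.2 ξ hξ)⟩

theorem IsNonnegLd.const_mul (h : IsNonnegLd d T k) {c : ℝ} (hc : 0 ≤ c) :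
    IsNonnegLd d T (fun ξ => c * k ξ) :=
  ⟨h.1.const_mul c, fun ξ hξ => mul_nonneg hc (h.2 ξ hξ)⟩

theorem IsNonnegLd.integrableOn (h : IsNonnegLd d T k) (hd : 1 ≤ d) :
    IntegrableOn k (Icc (0 : ℝ) T) :=
  h.1.integrable hd

theorem IsNonnegLd.intervalIntegrable (h : IsNonnegLd d T k) (hd : 1 ≤ d) {s t : ℝ≥0}
    (hst : s ≤ t) (ht : t ≤ T) : IntervalIntegrable k volume s t :=
  (intervalIntegrable_iff_integrableOn_Icc_of_le (by exact_mod_cast hst)).2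
    ((h.integrableOn hd).mono_set (Icc_subset_Icc s.2 (by exact_mod_cast ht)))

theorem IsNonnegLd.integral_nonneg (h : IsNonnegLd d T k) {s t : ℝ≥0} (hst : s ≤ t)
    (ht : t ≤ T) : 0 ≤ ∫ ξ in (s : ℝ)..t, k ξ :=
  intervalIntegral.integral_nonneg (by exact_mod_cast hst) fun ξ hξ =>
    h.2 ξ ⟨s.2.trans hξ.1, hξ.2.trans (by exact_mod_cast ht)⟩

/-- Absolute continuity of the primitive of a control function. -/
theorem IsNonnegLd.exists_integral_le (h : IsNonnegLd d T k) (hd : 1 ≤ d) {ε : ℝ} (hε : 0 < ε) :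
    ∃ δ : ℝ≥0, 0 < δ ∧ ∀ s t : ℝ≥0, s ≤ t → t ≤ T → t ≤ s + δ →
      ∫ ξ in (s : ℝ)..t, k ξ ≤ ε := by
  have hc : ContinuousOn (fun x => ∫ ξ in (0 : ℝ)..x, k ξ) (Icc (0 : ℝ) T) := by
    have := intervalIntegral.continuousOn_primitive_interval (μ := volume) (f := k) (a := 0)
      (b := (T : ℝ)) (by rw [uIcc_of_le T.coe_nonneg]; exact h.integrableOn hd)
    rwa [uIcc_of_le T.coe_nonneg] at this
  obtain ⟨δ, hδ, hu⟩ := Metric.uniformContinuousOn_iff_le.1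
    (isCompact_Icc.uniformContinuousOn_of_continuous hc) ε hε
  refine ⟨⟨δ, hδ.le⟩, hδ, fun s t hst ht hts => ?_⟩
  have hst' : (s : ℝ) ≤ t := by exact_mod_cast hst
  have hts' : (t : ℝ) ≤ s + δ := by exact_mod_cast hts
  have ht' : (t : ℝ) ≤ T := by exact_mod_cast ht
  have key := hu t ⟨t.2, ht'⟩ s ⟨s.2, hst'.trans ht'⟩ (by
    rw [Real.dist_eq, abs_of_nonneg (by linarith)]; linarith)
  have hint : ∀ x ≤ T, IntervalIntegrable k volume 0 x := fun x hx => by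
    simpa using h.intervalIntegrable (s := 0) hd bot_le hx
  rw [Real.dist_eq, intervalIntegral.integral_interval_sub_left (hint t ht)
    (hint s (hst.trans ht))] at key
  exact (le_abs_self _).trans key

end LoewnerDuality

/-! ### From reverse evolution families to Loewner chains -/

namespace LoewnerDuality

open Metric Filter Topology

variable {d : ℝ≥0∞} {φ : Triangle → 𝔻 → 𝔻}

theorem exists_norm_le_of_isCompact {K : Set 𝔻} (hK : IsCompact K) :
    ∃ R < 1, ∀ z ∈ K, ‖(z : ℂ)‖ ≤ R := by
  rcases K.eq_empty_or_nonempty with rfl | hne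
  · exact ⟨0, one_pos, by simp⟩
  · obtain ⟨w, -, hw⟩ := hK.exists_isMaxOn hne
      (Complex.UnitDisc.continuous_coe.norm.continuousOn)
    exact ⟨_, w.norm_lt_one, fun z hz => hw hz⟩

/-- Regularity at the two points `0` and `1 / 2` gives regularity uniformly on compact sets. -/
theorem IsReverseEvolutionFamily.exists_norm_sub_self_le (hφ : IsReverseEvolutionFamily d φ)
    {T : ℝ≥0} (hT : 0 < T) {R : ℝ} (hR : R < 1) (hd : 1 ≤ d) :
    ∃ k, IsNonnegLd d T k ∧ ∀ z : 𝔻, ‖(z : ℂ)‖ ≤ R → ∀ (u t : ℝ≥0) (hut : u ≤ t), t ≤ T →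
      ‖(φ (tri hut) z : ℂ) - z‖ ≤ ∫ ξ in (u : ℝ)..t, k ξ := by
  obtain ⟨k₀, hk₀, h₀⟩ := hφ.regular 0 T hT
  obtain ⟨k₁, hk₁, h₁⟩ := hφ.regular half T hT
  have hR1 : 0 < 1 - R := sub_pos.2 hR
  refine ⟨_, (hk₀.add hk₁).const_mul (c := 38 / (1 - R)) (by positivity),
    fun z hz u t hut ht => ?_⟩
  have e₀ := h₀ u u t le_rfl hut ht
  have e₁ := h₁ u u t le_rfl hut ht
  rw [hφ.diag, id, norm_sub_rev] at e₀ e₁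
  rw [Complex.UnitDisc.coe_zero, sub_zero] at e₀
  rw [intervalIntegral.integral_const_mul, intervalIntegral.integral_add
    (hk₀.intervalIntegrable hd hut ht) (hk₁.intervalIntegrable hd hut ht)]
  exact (hφ.holomorphic _).norm_sub_self_le
    (e₀.trans (le_add_of_nonneg_right (hk₁.integral_nonneg hut ht)))
    (e₁.trans (le_add_of_nonneg_left (hk₀.integral_nonneg hut ht))) hR hz

/-- The backward orbit `u ↦ φ_{u,t}(z)`, `0 ≤ u ≤ t`, stays in a compact subset of the disc. -/
theorem IsReverseEvolutionFamily.exists_norm_le (hφ : IsReverseEvolutionFamily d φ)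
    (hd : 1 ≤ d) (t : ℝ≥0) (z : 𝔻) :
    ∃ R < 1, ∀ (u : ℝ≥0) (hut : u ≤ t), ‖(φ (tri hut) z : ℂ)‖ ≤ R := by
  obtain ⟨k, hk, hreg⟩ := hφ.regular 0 (t + 1) (by positivity)
  obtain ⟨δ, hδ, hδk⟩ := hk.exists_integral_le hd one_half_pos
  have ht1 : t ≤ t + 1 := le_self_add
  -- going backward from `t` in steps of length `δ`, each step enlarges the bound to one below `1`
  have step : ∀ n : ℕ, ∃ R < 1, ∀ (u : ℝ≥0) (hut : u ≤ t), t ≤ u + n • δ →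
      ‖(φ (tri hut) z : ℂ)‖ ≤ R := by
    intro n
    induction n with
    | zero =>
      refine ⟨‖(z : ℂ)‖, z.norm_lt_one, fun u hut hu => ?_⟩
      obtain rfl : u = t := hut.antisymm (by simpa using hu)
      rw [hφ.diag, id]
    | succ n ih =>
      obtain ⟨R, hR, h⟩ := ih
      refine ⟨1 - (1 - R) / 8, by linarith, fun u hut hu => ?_⟩
      have huv : u ≤ min t (u + δ) := le_min hut le_self_add
      have hvt : min t (u + δ) ≤ t := min_le_left _ _
      have hv : t ≤ min t (u + δ) + n • δ := by
        rw [← min_add_add_right]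
        refine le_min le_self_add (hu.trans_eq ?_)
        rw [succ_nsmul, add_assoc, add_comm δ]
      have e := hreg u u _ le_rfl huv (hvt.trans ht1)
      rw [hφ.diag, id, norm_sub_rev, Complex.UnitDisc.coe_zero, sub_zero] at e
      rw [hφ.comp u _ t huv hvt]
      exact (hφ.holomorphic _).norm_le_of_norm_zero_le
        (e.trans (hδk u _ huv (hvt.trans ht1) (min_le_right _ _))) (h _ hvt hv) hR
  obtain ⟨n, hn⟩ := Archimedean.arch t hδ
  obtain ⟨R, hR, h⟩ := step n
  exact ⟨R, hR, fun u hut => h u hut (hn.trans le_add_self)⟩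

/-- The members of a reverse evolution family are univalent: on the compact set containing two
backward orbits, `φ_{u,v}` is injective as soon as `v - u` is small, so that two orbits which meet
at time `s` coincide up to time `t`. -/
theorem IsReverseEvolutionFamily.injective (hφ : IsReverseEvolutionFamily d φ) (hd : 1 ≤ d)
    {s t : ℝ≥0} (hst : s ≤ t) : Function.Injective (φ (tri hst)) := by
  intro z₁ z₂ hz
  obtain ⟨R₁, hR₁, h₁⟩ := hφ.exists_norm_le hd t z₁
  obtain ⟨R₂, hR₂, h₂⟩ := hφ.exists_norm_le hd t z₂
  set R := max R₁ R₂
  have hR : R < 1 := max_lt hR₁ hR₂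
  have hr : 0 < (1 - R) / 2 := by linarith
  obtain ⟨k, hk, hreg⟩ := hφ.exists_norm_sub_self_le (T := t + 1) (by positivity)
    (R := R + (1 - R) / 2) (by linarith) hd
  obtain ⟨δ, hδ, hδk⟩ := hk.exists_integral_le hd (ε := (1 - R) / 2 / 4) (by positivity)
  have ht1 : t ≤ t + 1 := le_self_add
  -- going forward from `s` in steps of length `δ`, the two orbits still coincide
  have step : ∀ n : ℕ, ∀ (v : ℝ≥0) (hvt : v ≤ t), s ≤ v → v ≤ s + n • δ →
      φ (tri hvt) z₁ = φ (tri hvt) z₂ := by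
    intro n
    induction n with
    | zero =>
      intro v hvt hsv hv
      obtain rfl : s = v := hsv.antisymm (by simpa using hv)
      exact hz
    | succ n ih =>
      intro v hvt hsv hv
      have huv : max s (v - δ) ≤ v := max_le hsv tsub_le_self
      have hu : max s (v - δ) ≤ s + n • δ := by
        refine max_le le_self_add (tsub_le_iff_right.2 (hv.trans_eq ?_))
        rw [succ_nsmul, add_assoc]
      have e := ih _ (huv.trans hvt) (le_max_left _ _) hu
      rw [hφ.comp _ v t huv hvt] at e
      refine (hφ.holomorphic _).eq_of_map_eq (η := (1 - R) / 2 / 4) (R := R) (r := (1 - R) / 2)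
        (by positivity)
        (by linarith) (by linarith) (fun y hy => ?_) ((h₁ v hvt).trans (le_max_left _ _))
        ((h₂ v hvt).trans (le_max_right _ _)) e
      exact (hreg y hy _ v huv (hvt.trans ht1)).trans
        (hδk _ v huv (hvt.trans ht1) (tsub_le_iff_right.1 (le_max_right _ _)))
  obtain ⟨n, hn⟩ := Archimedean.arch t hδ
  have e := step n t le_rfl hst (hn.trans le_add_self)
  rwa [hφ.diag] at e

theorem IsReverseEvolutionFamily.initial_comp (hφ : IsReverseEvolutionFamily d φ) {s t : ℝ≥0}
    (hst : s ≤ t) : initial φ t = initial φ s ∘ φ (tri hst) :=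
  hφ.comp 0 s t bot_le hst

theorem IsReverseEvolutionFamily.isDecreasingLoewnerChain_initial
    (hφ : IsReverseEvolutionFamily d φ) (hd : 1 ≤ d) :
    IsDecreasingLoewnerChain d (initial φ) where
  holomorphic t := hφ.holomorphic _
  univalent t := hφ.injective hd _
  zero := hφ.diag 0
  range_subset s t hst := by
    rw [hφ.initial_comp hst]
    exact range_comp_subset_range _ _
  regular K hK T hT := by
    obtain ⟨R, hR, hKR⟩ := exists_norm_le_of_isCompact hK
    obtain ⟨k, hk, hreg⟩ := hφ.exists_norm_sub_self_le hT hR hd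
    have hR1 : 0 < 1 - R := sub_pos.2 hR
    refine ⟨_, hk.const_mul (c := 2 / (1 - R)) (by positivity), fun z hz s t hst ht => ?_⟩
    rw [intervalIntegral.integral_const_mul, hφ.initial_comp hst]
    refine ((hφ.holomorphic _).norm_map_sub_map_le z _).trans ?_
    rw [norm_sub_rev]
    have := hKR z hz
    gcongr
    exact hreg z this s t hst ht

theorem IsReverseEvolutionFamily.transition_initial (hφ : IsReverseEvolutionFamily d φ)
    (hd : 1 ≤ d) : transition (initial φ) = φ := by
  funext ⟨⟨s, t⟩, hst⟩ z
  change Function.invFun (initial φ s) (initial φ t z) = φ (tri hst) z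
  rw [hφ.initial_comp hst]
  exact Function.leftInverse_invFun (hφ.injective hd _) _

/-! ### From Loewner chains to reverse evolution families -/

variable {f : ℝ≥0 → 𝔻 → 𝔻}

theorem IsDecreasingLoewnerChain.continuousOn_time (hf : IsDecreasingLoewnerChain d f)
    (hd : 1 ≤ d) {T : ℝ≥0} (hT : 0 < T) (z : 𝔻) :
    ContinuousOn (fun u => (f u z : ℂ)) (Iic T) := by
  obtain ⟨k, hk, hreg⟩ := hf.regular {z} isCompact_singleton T hT
  refine Metric.continuousOn_iff.2 fun u hu ε hε => ?_
  obtain ⟨δ, hδ, hδk⟩ := hk.exists_integral_le hd (half_pos hε)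
  refine ⟨δ, hδ, fun v hv huv => ?_⟩
  rw [NNReal.dist_eq, abs_lt] at huv
  refine lt_of_le_of_lt ?_ (half_lt_self hε)
  rw [dist_eq_norm]
  rcases le_total u v with h | h
  · rw [norm_sub_rev]
    refine (hreg z rfl u v h hv).trans (hδk u v h hv ?_)
    rw [← NNReal.coe_le_coe, NNReal.coe_add]
    linarith
  · refine (hreg z rfl v u h hu).trans (hδk v u h hu ?_)
    rw [← NNReal.coe_le_coe, NNReal.coe_add]
    linarith

theorem IsDecreasingLoewnerChain.continuousOn_prod (hf : IsDecreasingLoewnerChain d f)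
    (hd : 1 ≤ d) {T : ℝ≥0} (hT : 0 < T) :
    ContinuousOn (fun p : ℝ≥0 × 𝔻 => (f p.1 p.2 : ℂ)) (Iic T ×ˢ univ) := by
  rintro ⟨u, w⟩ ⟨hu, -⟩
  -- the maps `f v` share the Lipschitz constant `2 / (1 - |w|)` at `w`
  have h1 : Tendsto (fun p : ℝ≥0 × 𝔻 => ‖(f p.1 w : ℂ) - f u w‖) (𝓝[Iic T ×ˢ univ] (u, w))
      (𝓝 0) := by
    have := (hf.continuousOn_time hd hT w) u hu
    refine (tendsto_iff_norm_sub_tendsto_zero.1 this).comp ?_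
    rw [nhdsWithin_prod_eq]
    exact tendsto_fst
  have h2 : Tendsto (fun p : ℝ≥0 × 𝔻 => 2 / (1 - ‖(w : ℂ)‖) * ‖(w : ℂ) - p.2‖)
      (𝓝[Iic T ×ˢ univ] (u, w)) (𝓝 0) := by
    have hc : Continuous fun p : ℝ≥0 × 𝔻 => 2 / (1 - ‖(w : ℂ)‖) * ‖(w : ℂ) - p.2‖ := by
      have := Complex.UnitDisc.continuous_coe
      fun_prop
    simpa using (hc.tendsto (u, w)).mono_left nhdsWithin_le_nhds
  refine tendsto_iff_norm_sub_tendsto_zero.2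
    (squeeze_zero (fun _ => norm_nonneg _) (fun p => ?_) (by simpa using h2.add h1))
  refine (norm_sub_le_norm_sub_add_norm_sub _ (f p.1 w : ℂ) _).trans ?_
  gcongr
  rw [norm_sub_rev]
  exact (hf.holomorphic p.1).norm_map_sub_map_le w p.2

/-- By compactness, the maps `f u`, `u ≤ T`, satisfy a common lower Lipschitz bound at `z`. -/
theorem IsDecreasingLoewnerChain.exists_norm_sub_le (hf : IsDecreasingLoewnerChain d f)
    (hd : 1 ≤ d) {T : ℝ≥0} (hT : 0 < T) (z : 𝔻) :
    ∃ C : ℝ, 0 ≤ C ∧ ∀ u ≤ T, ∀ w : 𝔻, ‖(w : ℂ) - z‖ ≤ C * ‖(f u w : ℂ) - f u z‖ := by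
  set r : ℝ := (1 - ‖(z : ℂ)‖) / 2 with hr
  have hr0 : 0 < r := by have := z.norm_lt_one; linarith
  have hball : closedBall (z : ℂ) r ⊆ ball 0 1 := fun x hx => by
    rw [mem_closedBall_iff_norm] at hx
    rw [mem_ball_zero_iff]
    have := norm_le_norm_add_norm_sub' x (z : ℂ)
    linarith
  set S : Set 𝔻 := (fun w : 𝔻 => (w : ℂ)) ⁻¹' sphere (z : ℂ) r with hS
  have hScomp : IsCompact S :=
    Complex.UnitDisc.isEmbedding_coe.isInducing.isCompact_preimage' (isCompact_sphere _ _)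
      fun x hx => by
        lift x to 𝔻 using by simpa using hball (sphere_subset_closedBall hx)
        exact ⟨x, rfl⟩
  have hcomp : IsCompact (Iic T ×ˢ S) := by
    rw [← Icc_bot]
    exact isCompact_Icc.prod hScomp
  have hmono : Iic T ×ˢ S ⊆ Iic T ×ˢ univ := prod_mono_right (subset_univ _)
  have hz : ContinuousOn (fun p : ℝ≥0 × 𝔻 => (f p.1 z : ℂ)) (Iic T ×ˢ S) :=
    (hf.continuousOn_time hd hT z).comp continuousOn_fst fun p hp => hp.1
  obtain ⟨ε, hε, hmin⟩ := hcomp.exists_forall_le' (a := 0)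
    ((((hf.continuousOn_prod hd hT).mono hmono).sub hz).norm) (fun p hp => by
      refine norm_pos_iff.2 (sub_ne_zero.2 fun e => ?_)
      have e' : p.2 = z := hf.univalent _ (Complex.UnitDisc.coe_injective e)
      have e2 : (p.2 : ℂ) ∈ sphere (z : ℂ) r := hp.2
      rw [e', mem_sphere, dist_self] at e2
      exact hr0.ne e2)
  exact ⟨4 / ε, by positivity, fun u hu w =>
    (hf.holomorphic u).norm_sub_le_of_injective (hf.univalent u) hr0 hε hball
      (fun w hw => hmin (u, w) ⟨hu, hw⟩) w⟩

theorem IsDecreasingLoewnerChain.isReverseEvolutionFamily_transition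
    (hf : IsDecreasingLoewnerChain d f) (hd : 1 ≤ d) :
    IsReverseEvolutionFamily d (transition f) := by
  have hhol : ∀ p, IsHolomorphic (transition f p) := fun p =>
    (hf.holomorphic _).of_comp_eq (hf.holomorphic _) (hf.univalent _) (hf.univalent _)
      (apply_transition hf p)
  have hdiag : ∀ s, transition f (tri (le_refl s)) = id := fun s =>
    Function.invFun_comp (hf.univalent s)
  have hcomp : ∀ (s u t : ℝ≥0) (hsu : s ≤ u) (hut : u ≤ t),
      transition f (tri (hsu.trans hut)) = transition f (tri hsu) ∘ transition f (tri hut) := by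
    intro s u t hsu hut
    funext z
    refine hf.univalent s ?_
    exact (apply_transition hf (tri (hsu.trans hut)) z).trans
      ((apply_transition hf (tri hut) z).symm.trans
        (apply_transition hf (tri hsu) (transition f (tri hut) z)).symm)
  refine ⟨hhol, hdiag, hcomp, fun z T hT => ?_⟩
  obtain ⟨C, hC, hlow⟩ := hf.exists_norm_sub_le hd hT z
  obtain ⟨k, hk, hreg⟩ := hf.regular {z} isCompact_singleton T hT
  have hz : 0 < 1 - ‖(z : ℂ)‖ := sub_pos.2 z.norm_lt_one
  refine ⟨_, hk.const_mul (c := 2 / (1 - ‖(z : ℂ)‖) * C) (by positivity),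
    fun s u t hsu hut ht => ?_⟩
  rw [intervalIntegral.integral_const_mul, hcomp s u t hsu hut, mul_assoc]
  refine ((hhol _).norm_map_sub_map_le z _).trans ?_
  rw [norm_sub_rev]
  gcongr
  refine (hlow u (hut.trans ht) _).trans ?_
  rw [show f u (transition f (tri hut) z) = f t z from apply_transition hf (tri hut) z,
    norm_sub_rev]
  gcongr
  exact hreg z rfl u t hut ht

theorem initial_transition (hf : IsDecreasingLoewnerChain d f) : initial (transition f) = f := by
  funext t z
  have := apply_transition hf (tri (bot_le : 0 ≤ t)) z
  change f 0 _ = f t z at this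
  rwa [hf.zero] at this

end LoewnerDuality

theorem theorem4p1 (d : ℝ≥0∞) (hd : 1 ≤ d) :
    Set.BijOn LoewnerDuality.transition
      {f | LoewnerDuality.IsDecreasingLoewnerChain d f}
      {φ | LoewnerDuality.IsReverseEvolutionFamily d φ} ∧
    (∀ f : ℝ≥0 → 𝔻 → 𝔻, LoewnerDuality.IsDecreasingLoewnerChain d f →
      LoewnerDuality.IsReverseEvolutionFamily d (LoewnerDuality.transition f)) ∧
    (∀ φ : LoewnerDuality.Triangle → 𝔻 → 𝔻, LoewnerDuality.IsReverseEvolutionFamily d φ →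
      LoewnerDuality.IsDecreasingLoewnerChain d (LoewnerDuality.initial φ) ∧
      LoewnerDuality.transition (LoewnerDuality.initial φ) = φ) := by
  have h1 := fun (f : ℝ≥0 → 𝔻 → 𝔻) (hf : LoewnerDuality.IsDecreasingLoewnerChain d f) =>
    hf.isReverseEvolutionFamily_transition hd
  have h2 := fun (φ : LoewnerDuality.Triangle → 𝔻 → 𝔻)
    (hφ : LoewnerDuality.IsReverseEvolutionFamily d φ) =>
    And.intro (hφ.isDecreasingLoewnerChain_initial hd) (hφ.transition_initial hd)
  refine ⟨Set.InvOn.bijOn (f' := LoewnerDuality.initial)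
    ⟨fun f hf => LoewnerDuality.initial_transition hf, fun φ hφ => (h2 φ hφ).2⟩ h1
    fun φ hφ => (h2 φ hφ).1, h1, h2⟩
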